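/- Let $A$ be a torsion-free Abelian group of finite rank (that is, $\dim_{\mathbb{Q}}(\mathbb{Q}\otimes A)<\infty$), and let $\operatorname{End} A$ be its endomorphism ring, acting on $A$ from the left. Suppose that $\operatorname{End} A$ is centrally essential: for every non-zero $a\in\operatorname{End} A$ there exist non-zero central elements $x,y\in\operatorname{End} A$ with $ax=y$. Then $A$ is faithful: for every proper right ideal $I$ of $\operatorname{End} A$ one has $IA\neq A$, where $IA$ is the subgroup of $A$ generated by all elements $f(a)$ with $f\in I$ and $a\in A$. -/

import Mathlib

universe u

/-- A ring is centrally essential if for every non-zero element `a` there are non-zero central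
elements `x`, `y` with `a * x = y`. -/
def IsCentrallyEssential (R : Type u) [Ring R] : Prop :=
  ∀ a : R, a ≠ 0 → ∃ x ∈ Subring.center R, ∃ y ∈ Subring.center R, x ≠ 0 ∧ y ≠ 0 ∧ a * x = y

/-- Right ideals of a ring `R`: submodules of `R`, on which `R` acts by right multiplication. -/
abbrev RightIdeal (R : Type u) [Ring R] : Type u :=
  Submodule (MulOpposite R) R

/-- For a right ideal `I` of the endomorphism ring of `A` (with composition as multiplication, so
that `A` is a left module), the subgroup `IA` of `A`: all finite sums of elements `f a` with
`f ∈ I` and `a ∈ A`. -/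
def RightIdeal.mulGroup {A : Type u} [AddCommGroup A] (I : RightIdeal (AddMonoid.End A)) :
    AddSubgroup A :=
  AddSubgroup.closure {x : A | ∃ f ∈ I, ∃ a : A, f a = x}

/-- An Abelian group `A` is faithful if `IA ≠ A` for every proper right ideal `I` of `End A`. -/
def IsFaithfulGroup (A : Type u) [AddCommGroup A] : Prop :=
  ∀ I : RightIdeal (AddMonoid.End A), I ≠ ⊤ → I.mulGroup ≠ ⊤

/-- An Abelian group has finite rank if its maximal linearly independent (over the integers)
subsets are finite. -/
def HasFiniteRank (A : Type u) [AddCommGroup A] : Prop :=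
  Module.rank ℤ A < Cardinal.aleph0

/-! `End A` embeds in the finite-dimensional algebra `End_ℚ(ℚ ⊗ A)`. With central essentiality this
makes every inner derivation locally nilpotent (`IsCentrallyEssential.isEngelRing`), a property that
passes to quotients and to the rational span and makes idempotents central. In an Artinian algebra
with central idempotents, a right ideal `N` with `NW = W` for a faithful finitely generated module
`W` contains `1` (`RightIdeal.one_mem_of_smul_eq_top`). If `IA = A`, this is used twice: over `ℚ ⊗
A` it puts some integer `n ≠ 0` in `I`, and over the finite group `A / nA` it then puts `1` in `I`.
-/

/-- Every inner derivation `y ↦ x * y - y * x` of the ring is locally nilpotent. -/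
def IsEngelRing (R : Type*) [Ring R] : Prop :=
  ∀ x y : R, ∃ m : ℕ, (fun z => x * z - z * x)^[m] y = 0

/-- The inner derivation `D` of an idempotent satisfies `D³ = D`, so it is locally nilpotent only if
it vanishes. -/
theorem IsEngelRing.commute_of_isIdempotentElem {R : Type*} [Ring R] (hR : IsEngelRing R)
    {e : R} (he : e * e = e) (y : R) : e * y = y * e := by
  set D : R → R := fun z => e * z - z * e with hD
  have hcube : ∀ z, D (D (D z)) = D z := by
    intro z
    have h1 : ∀ w, e * (e * w) = e * w := fun w => by rw [← mul_assoc, he]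
    have h2 : D (D z) = e * z + z * e - 2 • (e * (z * e)) := by
      simp only [hD, mul_sub, sub_mul, mul_assoc, he, h1]
      abel
    rw [h2]
    simp only [hD, mul_sub, sub_mul, mul_assoc, he, h1, mul_add, add_mul, two_nsmul]
    abel
  have hiter : ∀ m : ℕ, D^[2 * m + 1] y = D y := by
    intro m
    induction m with
    | zero => rfl
    | succ m ih =>
      rw [show 2 * (m + 1) + 1 = (2 * m + 1) + 1 + 1 by ring, Function.iterate_succ_apply',
        Function.iterate_succ_apply', ih, hcube]
  obtain ⟨m, hm⟩ := hR e y
  have hzero : ∀ k : ℕ, D^[k + m] y = 0 := by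
    intro k
    rw [Function.iterate_add_apply, hm]
    exact Function.iterate_fixed (by simp [hD]) k
  have h := hiter m
  rw [show 2 * m + 1 = (m + 1) + m by ring, hzero] at h
  exact sub_eq_zero.mp h.symm

/-! ### Right ideals of Artinian algebras with central idempotents -/

theorem RightIdeal.mul_mem {T : Type u} [Ring T] (N : RightIdeal T) {f : T} (hf : f ∈ N) (t : T) :
    f * t ∈ N :=
  N.smul_mem (MulOpposite.op t) hf

/-- In an algebra that is an Artinian module over its scalars, every `f` has a right multiple that
is idempotent and acts on some power of `f` as a right identity. -/
theorem exists_idempotent_mul_pow_eq (k : Type*) {T : Type*} [CommRing k] [Ring T] [Algebra k T]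
    [IsArtinian k T] (f : T) :
    ∃ (n : ℕ) (g : T), (f * g) * (f * g) = f * g ∧ f ^ n * (f * g) = f ^ n := by
  let S := Algebra.adjoin k ({f} : Set T)
  have : IsMulCommutative S := Algebra.isMulCommutative_adjoin k (by
    intro a ha b hb
    rw [Set.mem_singleton_iff.mp ha, Set.mem_singleton_iff.mp hb])
  have : IsArtinian k S := isArtinian_submodule' (Subalgebra.toSubmodule S)
  have : IsArtinian S S := isArtinian_of_tower k inferInstance
  let s : S := ⟨f, Algebra.self_mem_adjoin_singleton k f⟩
  -- The descending chain of powers of `s` stops in the commutative algebra `S`: `s ^ (n + 1) * y =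
  -- s ^ n`. The idempotent will be `s ^ (n + 1) * y ^ (n + 1)`.
  obtain ⟨n, y, hy⟩ := IsArtinian.exists_pow_succ_smul_dvd s (1 : S)
  simp only [smul_eq_mul, mul_one, Nat.succ_eq_add_one] at hy
  have hpow : ∀ j : ℕ, s ^ (n + j) * y ^ j = s ^ n := by
    intro j
    induction j with
    | zero => simp
    | succ j ih =>
      calc s ^ (n + (j + 1)) * y ^ (j + 1) = s ^ j * (s ^ (n + 1) * y) * y ^ j := by ring
        _ = s ^ (n + j) * y ^ j := by rw [hy]; ring
        _ = s ^ n := ih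
  have h := hpow (n + 1)
  have h1 : s ^ n * (s ^ (n + 1) * y ^ (n + 1)) = s ^ n := by
    calc _ = s ^ (n + (n + 1)) * y ^ (n + 1) := by ring
      _ = s ^ n := h
  refine ⟨n, (s ^ n * y ^ (n + 1) : S), ?_, ?_⟩
  · have : (s * (s ^ n * y ^ (n + 1))) * (s * (s ^ n * y ^ (n + 1))) =
        s * (s ^ n * y ^ (n + 1)) := by
      calc _ = s * (s ^ n * (s ^ (n + 1) * y ^ (n + 1))) * y ^ (n + 1) := by ring
        _ = _ := by rw [h1]; ring
    exact congrArg Subtype.val this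
  · have : s ^ n * (s * (s ^ n * y ^ (n + 1))) = s ^ n := by
      rw [← mul_assoc s, ← pow_succ']; exact h1
    exact congrArg Subtype.val this

theorem mem_jacobson_of_isNilpotent_mul {T : Type*} [Ring T] {x : T}
    (hx : ∀ t, IsNilpotent (x * t)) : x ∈ Ring.jacobson T := by
  have : x ∈ Ideal.jacobson (⊥ : Ideal T) := by
    rw [Ideal.mem_jacobson_iff]
    intro y
    have hyx : IsNilpotent (y * x) := by
      obtain ⟨n, hn⟩ := hx y
      refine ⟨n + 1, ?_⟩
      have : (y * x) ^ (n + 1) = y * (x * y) ^ n * x := by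
        have hsemi : SemiconjBy x (y * x) (x * y) := (mul_assoc x y x).symm
        rw [pow_succ', mul_assoc, mul_assoc, (hsemi.pow_right n).eq]
      rw [this, hn, mul_zero, zero_mul]
    obtain ⟨z, hz⟩ := hyx.isUnit_one_add.exists_left_inv
    refine ⟨z, ?_⟩
    rw [Ideal.mem_bot, ← hz]
    noncomm_ring
  rw [Ring.jacobson_eq_sInf_isMaximal]
  simpa [Ideal.jacobson] using this

/-- Take an idempotent `e ∈ N` with minimal right annihilator. Then `N(1 - e)` lies in the Jacobson
radical, so Nakayama's lemma kills `(1 - e)W`, and faithfulness gives `e = 1`. -/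
theorem RightIdeal.one_mem_of_smul_eq_top (k : Type*) {T : Type u} {W : Type*} [CommRing k]
    [Ring T] [Algebra k T] [IsArtinian k T] [AddCommGroup W] [Module T W] [Module.Finite T W]
    (hfaithful : ∀ t : T, (∀ w : W, t • w = 0) → t = 0)
    (hcentral : ∀ e : T, e * e = e → ∀ t, e * t = t * e) (N : RightIdeal T)
    (hN : AddSubgroup.closure {x : W | ∃ f ∈ N, ∃ w : W, f • w = x} = ⊤) : (1 : T) ∈ N := by
  obtain ⟨_, ⟨e, heN, he, rfl⟩, hmin⟩ := IsArtinian.set_has_minimal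
    {K : Submodule k T | ∃ e ∈ N, e * e = e ∧ K = LinearMap.ker (LinearMap.mulLeft k e)}
    ⟨_, 0, N.zero_mem, by simp, rfl⟩
  have hec := hcentral e he
  have hnil : ∀ f ∈ N, IsNilpotent (f * (1 - e)) := by
    intro f hf
    have hf' : f * (1 - e) ∈ N := N.mul_mem hf _
    have hef : e * (f * (1 - e)) = 0 := by
      rw [← mul_assoc, hec, mul_assoc, mul_sub, he]; simp
    obtain ⟨n, g, hidem, hpow⟩ := exists_idempotent_mul_pow_eq k (f * (1 - e))
    set e' := f * (1 - e) * g with he'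
    have hee' : e * e' = 0 := by rw [he', ← mul_assoc, hef, zero_mul]
    have he'e : e' * e = 0 := by rw [← hec, hee']
    have hsum : (e + e') * (e + e') = e + e' := by
      simp only [mul_add, add_mul, he, hidem, hee', he'e]; simp
    have hlt := hmin _ ⟨e + e', N.add_mem heN (N.mul_mem hf' g), hsum, rfl⟩
    have hle : LinearMap.ker (LinearMap.mulLeft k (e + e')) ≤
        LinearMap.ker (LinearMap.mulLeft k e) := by
      intro t ht
      rw [LinearMap.mem_ker, LinearMap.mulLeft_apply] at ht ⊢
      have : e * ((e + e') * t) = e * t := by rw [← mul_assoc, mul_add, he, hee', add_zero]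
      rw [← this, ht, mul_zero]
    -- `e'` is killed by `e`, hence by minimality also by `e + e'`; but `(e + e') * e' = e'`.
    have hmem : e' ∈ LinearMap.ker (LinearMap.mulLeft k (e + e')) := by
      by_contra hcon
      exact hlt (lt_of_le_not_ge hle fun hge => hcon (hge (by simpa using hee')))
    have hzero : e' = 0 := by
      simpa [add_mul, hee', hidem] using hmem
    exact ⟨n, by rw [← hpow, hzero, mul_zero]⟩
  have hsub : ∀ t, (1 - e) * t = t * (1 - e) := fun t => by
    rw [sub_mul, mul_sub, hec, one_mul, mul_one]
  have hjac : ∀ f ∈ N, f * (1 - e) ∈ Ring.jacobson T := by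
    intro f hf
    refine mem_jacobson_of_isNilpotent_mul fun t => ?_
    have : f * (1 - e) * t = f * t * (1 - e) := by
      rw [mul_assoc, mul_assoc, hsub]
    rw [this]
    exact hnil _ (N.mul_mem hf t)
  let P : W →ₗ[T] W :=
    { toFun := fun w => (1 - e) • w
      map_add' := fun v w => smul_add _ v w
      map_smul' := fun t w => by simp only [RingHom.id_apply, smul_smul, hsub] }
  have hPP : ∀ w, P (P w) = P w := fun w => by
    change (1 - e) • (1 - e) • w = (1 - e) • w
    rw [smul_smul]
    congr 1
    simp [mul_sub, sub_mul, he]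
  have hfg : (LinearMap.range P).FG := by
    rw [← Submodule.map_top]
    exact Module.Finite.fg_top.map P
  have hbot : LinearMap.range P = ⊥ := by
    refine hfg.eq_bot_of_le_jacobson_smul ?_
    rintro _ ⟨w, rfl⟩
    have hw : w ∈ AddSubgroup.closure {x : W | ∃ f ∈ N, ∃ w : W, f • w = x} := by
      rw [hN]; trivial
    induction hw using AddSubgroup.closure_induction with
    | mem x hx =>
      obtain ⟨f, hf, v, rfl⟩ := hx
      have : P (f • v) = (f * (1 - e)) • P v := by
        rw [mul_smul, map_smul]
        exact congrArg (f • ·) (hPP v).symm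
      rw [this]
      exact Submodule.smul_mem_smul (hjac f hf) ⟨v, rfl⟩
    | zero => simp
    | add x y _ _ hx hy => rw [map_add]; exact add_mem hx hy
    | neg x _ hx => rw [map_neg]; exact neg_mem hx
  have h1e : 1 - e = 0 := hfaithful _ fun w => by
    have : P w ∈ LinearMap.range P := ⟨w, rfl⟩
    rw [hbot] at this
    exact this
  rw [sub_eq_zero.mp h1e]
  exact heN

/-! ### Local nilpotency from central essentiality -/

theorem IsEngelRing.of_surjective {R T : Type*} [Ring R] [Ring T] (hR : IsEngelRing R)
    (f : R →+* T) (hf : Function.Surjective f) : IsEngelRing T := by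
  intro x y
  obtain ⟨x, rfl⟩ := hf x
  obtain ⟨y, rfl⟩ := hf y
  obtain ⟨m, hm⟩ := hR x y
  refine ⟨m, ?_⟩
  have hsemi : Function.Semiconj f (fun z => x * z - z * x) (fun z => f x * z - z * f x) :=
    fun z => by simp
  rw [← (hsemi.iterate_right m).eq, hm, map_zero]

/-- By finite dimension the kernels of the powers of `D` stabilize at some `m`. If `D^m y ≠ 0`,
multiply it by a central `c` to get a non-zero central `d = D^m (y * c)`. Then `D d = 0`, so
stability forces `d = 0`. -/
theorem IsCentrallyEssential.isEngelRing {R : Type u} [Ring R] (hR : IsCentrallyEssential R)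
    {k E : Type*} [Field k] [Ring E] [Algebra k E] [FiniteDimensional k E] (φ : R →+* E)
    (hφ : Function.Injective φ) : IsEngelRing R := by
  intro x y
  set D : R → R := fun z => x * z - z * x with hD
  let L : E →ₗ[k] E := LinearMap.mulLeft k (φ x) - LinearMap.mulRight k (φ x)
  have hsemi : Function.Semiconj φ D L := fun z => by simp [D, L]
  have hiter : ∀ (m : ℕ) (z : R), φ (D^[m] z) = (L ^ m) (φ z) := fun m z => by
    rw [(hsemi.iterate_right m).eq, Module.End.pow_apply]
  obtain ⟨m, hm⟩ := monotone_stabilizes_iff_noetherian.mpr inferInstance L.iterateKer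
  have hstable : ∀ z, D^[m + 1] z = 0 → D^[m] z = 0 := by
    intro z hz
    have h1 : φ z ∈ L.iterateKer (m + 1) := by
      change (L ^ (m + 1)) (φ z) = 0
      rw [← hiter, hz, map_zero]
    rw [← hm (m + 1) m.le_succ] at h1
    have h2 : (L ^ m) (φ z) = 0 := h1
    rw [← hiter] at h2
    exact hφ (by rw [h2, map_zero])
  refine ⟨m, ?_⟩
  by_contra hne
  obtain ⟨c, hc, d, hd, -, hd0, hcd⟩ := hR _ hne
  rw [Subring.mem_center_iff] at hc hd
  have hmul : Function.Semiconj (· * c) D D := fun z => by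
    simp only [hD, sub_mul, mul_assoc, hc x]
  have hpow : D^[m] (y * c) = d := by
    rw [← hcd]
    exact ((hmul.iterate_right m).eq y).symm
  refine hd0 (hpow.symm.trans (hstable _ ?_))
  rw [Function.iterate_succ_apply', hpow]
  exact sub_eq_zero.mpr (hd x)

/-! ### Reduction modulo `n` -/

theorem HasFiniteRank.finite_quotient_range_nsmul {A : Type u} [AddCommGroup A]
    [IsAddTorsionFree A] (hA : HasFiniteRank A) {n : ℕ} (hn : n ≠ 0) :
    Finite (A ⧸ (nsmulAddMonoidHom n : A →+ A).range) := by
  by_contra hinf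
  rw [not_finite_iff_infinite] at hinf
  set Q := A ⧸ (nsmulAddMonoidHom n : A →+ A).range
  obtain ⟨s, hs⟩ := Infinite.exists_superset_card_eq (α := Q) ∅
    (n ^ Module.finrank ℤ A + 1) (by simp)
  classical
  -- Lifts of too many classes span a finitely generated `F` with `|F / nF| = n ^ rank F`, which is
  -- at most `n ^ rank A`.
  let F : Submodule ℤ A := Submodule.span ℤ (s.image Quotient.out : Finset A)
  have : Module.Finite ℤ F := Module.Finite.span_finset ℤ _
  have hidx := AddSubgroup.index_range_nsmul F n
  rw [AddSubgroup.index_eq_card] at hidx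
  have : Finite (F ⧸ (nsmulAddMonoidHom n : F →+ F).range) :=
    Nat.finite_of_card_ne_zero (by rw [hidx]; exact pow_ne_zero _ hn)
  let g : F ⧸ (nsmulAddMonoidHom n : F →+ F).range →+ Q :=
    QuotientAddGroup.map _ _ F.subtype.toAddMonoidHom (by
      rintro _ ⟨a, rfl⟩
      exact ⟨a, by simp⟩)
  have hsub : (s : Set Q) ⊆ Set.range g := by
    intro q hq
    refine ⟨QuotientAddGroup.mk ⟨q.out, Submodule.subset_span ?_⟩, ?_⟩
    · exact Finset.mem_coe.mpr (Finset.mem_image_of_mem _ hq)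
    · exact QuotientAddGroup.out_eq' q
  have hcard : s.card ≤ n ^ Module.finrank ℤ F := by
    rw [← hidx, ← Set.ncard_coe_finset]
    refine (Set.ncard_le_ncard hsub (Set.finite_range g)).trans ?_
    rw [← Nat.card_coe_set_eq]
    exact Finite.card_range_le g
  have hrank : Module.finrank ℤ F ≤ Module.finrank ℤ A :=
    Cardinal.toNat_le_toNat (Submodule.rank_le F) hA
  have := Nat.pow_le_pow_right (Nat.pos_of_ne_zero hn) hrank
  omega

/-- The action of `End A` on `A / nA`. -/
def endQuotientNSMul (A : Type u) [AddCommGroup A] (n : ℕ) :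
    AddMonoid.End A →+* AddMonoid.End (A ⧸ (nsmulAddMonoidHom n : A →+ A).range) where
  toFun f := QuotientAddGroup.map _ _ f (by
    rintro _ ⟨a, rfl⟩
    exact ⟨f a, (map_nsmul f n a).symm⟩)
  map_one' := QuotientAddGroup.addMonoidHom_ext _ rfl
  map_mul' f g := QuotientAddGroup.addMonoidHom_ext _ rfl
  map_zero' := QuotientAddGroup.addMonoidHom_ext _ rfl
  map_add' f g := QuotientAddGroup.addMonoidHom_ext _ rfl

theorem endQuotientNSMul_apply_mk {A : Type u} [AddCommGroup A] (n : ℕ) (f : AddMonoid.End A)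
    (a : A) : endQuotientNSMul A n f (QuotientAddGroup.mk a) = QuotientAddGroup.mk (f a) :=
  rfl

theorem exists_eq_natCast_mul_of_endQuotientNSMul_eq_zero {A : Type u} [AddCommGroup A]
    [IsAddTorsionFree A] {n : ℕ} (hn : n ≠ 0) {f : AddMonoid.End A}
    (hf : endQuotientNSMul A n f = 0) : ∃ g : AddMonoid.End A, f = n * g := by
  have hdiv : ∀ a, ∃ b, n • b = f a := by
    intro a
    have h : endQuotientNSMul A n f (QuotientAddGroup.mk a) = 0 := by rw [hf]; rfl
    rw [endQuotientNSMul_apply_mk, QuotientAddGroup.eq_zero_iff] at h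
    exact h
  choose g hg using hdiv
  have hinj := nsmul_right_injective (M := A) hn
  have hadd : ∀ a b, g (a + b) = g a + g b := fun a b =>
    hinj (by simp only [nsmul_add, hg, map_add])
  let G : AddMonoid.End A := AddMonoidHom.mk' g hadd
  have hG : f = n • G := AddMonoidHom.ext fun a => (hg a).symm
  exact ⟨G, hG.trans (nsmul_eq_mul n G)⟩

/-- Acting on the finite group `A / nA`, the image of `I` contains `1`. The kernel of this action is
`n End A`, which lies in `I`. -/
theorem RightIdeal.one_mem_of_natCast_mem {A : Type u} [AddCommGroup A] [IsAddTorsionFree A]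
    (hrank : HasFiniteRank A) (hA : IsEngelRing (AddMonoid.End A))
    {I : RightIdeal (AddMonoid.End A)} (hI : I.mulGroup = ⊤) {n : ℕ} (hn : n ≠ 0)
    (hnI : (n : AddMonoid.End A) ∈ I) : (1 : AddMonoid.End A) ∈ I := by
  have hfin := hrank.finite_quotient_range_nsmul hn
  set Q := A ⧸ (nsmulAddMonoidHom n : A →+ A).range
  let ψ := endQuotientNSMul A n
  let T := ψ.range
  have : Finite (AddMonoid.End Q) := DFunLike.finite (AddMonoid.End Q)
  have : IsArtinian ℤ T := isArtinian_of_finite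
  have hT : IsEngelRing T := hA.of_surjective ψ.rangeRestrict ψ.rangeRestrict_surjective
  let N : RightIdeal T :=
    { carrier := {t | ∃ f ∈ I, ψ f = t}
      zero_mem' := ⟨0, I.zero_mem, map_zero ψ⟩
      add_mem' := by
        rintro _ _ ⟨f, hf, hf'⟩ ⟨g, hg, hg'⟩
        exact ⟨f + g, I.add_mem hf hg, by rw [map_add, hf', hg']; rfl⟩
      smul_mem' := by
        rintro ⟨_, g, rfl⟩ _ ⟨f, hf, hf'⟩
        exact ⟨f * g, I.mul_mem hf g, by rw [map_mul, hf']; rfl⟩ }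
  have hone : (1 : T) ∈ N := by
    refine N.one_mem_of_smul_eq_top ℤ (W := Q) ?_
      (fun e he => hT.commute_of_isIdempotentElem he) ?_
    · intro t ht
      exact Subtype.ext (AddMonoidHom.ext ht)
    · rw [eq_top_iff]
      rintro q -
      obtain ⟨a, rfl⟩ := QuotientAddGroup.mk_surjective q
      have ha : a ∈ I.mulGroup := by rw [hI]; trivial
      induction ha using AddSubgroup.closure_induction with
      | mem x hx =>
        obtain ⟨f, hf, b, rfl⟩ := hx
        exact AddSubgroup.subset_closure
          ⟨⟨ψ f, f, rfl⟩, ⟨f, hf, rfl⟩, QuotientAddGroup.mk b, rfl⟩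
      | zero => exact zero_mem _
      | add x y _ _ hx hy => exact add_mem hx hy
      | neg x _ hx => exact neg_mem hx
  obtain ⟨f, hf, hf1⟩ := hone
  obtain ⟨g, hg⟩ := exists_eq_natCast_mul_of_endQuotientNSMul_eq_zero hn (f := 1 - f) (by
    rw [map_sub, map_one, sub_eq_zero]
    exact hf1.symm)
  rw [← sub_add_cancel 1 f, hg]
  exact I.add_mem (I.mul_mem hnI g) hf

/-! ### Passage to the rational hull -/

/-- A rational hull of `A`, on which the endomorphisms of `A` act. -/
structure RationalHull (A V : Type*) [AddCommGroup A] [AddCommGroup V] [Module ℚ V] where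
  /-- The embedding of the group into its rational hull. -/
  incl : A →+ V
  /-- The extension of endomorphisms to the rational hull. -/
  extend : AddMonoid.End A →+* Module.End ℚ V
  incl_injective : Function.Injective incl
  exists_smul_eq : ∀ v : V, ∃ n : ℕ, n ≠ 0 ∧ ∃ a : A, n • v = incl a
  extend_incl : ∀ f a, extend f (incl a) = incl (f a)

namespace RationalHull

theorem extend_injective {A V : Type*} [AddCommGroup A] [AddCommGroup V] [Module ℚ V]
    (H : RationalHull A V) : Function.Injective H.extend := by
  intro f g hfg
  ext a
  apply H.incl_injective
  rw [← H.extend_incl, ← H.extend_incl, hfg]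

/-- The rational span of `End A` in the endomorphism algebra of the rational hull. -/
def spanEnd {A V : Type*} [AddCommGroup A] [AddCommGroup V] [Module ℚ V]
    (H : RationalHull A V) : Subalgebra ℚ (Module.End ℚ V) where
  carrier := {t | ∃ n : ℕ, n ≠ 0 ∧ ∃ f, n • t = H.extend f}
  mul_mem' := by
    rintro s t ⟨m, hm, f, hf⟩ ⟨n, hn, g, hg⟩
    exact ⟨m * n, mul_ne_zero hm hn, f * g, by rw [map_mul, ← hf, ← hg, smul_mul_smul_comm]⟩
  add_mem' := by
    rintro s t ⟨m, hm, f, hf⟩ ⟨n, hn, g, hg⟩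
    refine ⟨m * n, mul_ne_zero hm hn, n • f + m • g, ?_⟩
    rw [map_add, map_nsmul, map_nsmul, ← hf, ← hg, smul_smul, smul_smul, smul_add, mul_comm n m]
  algebraMap_mem' q := by
    refine ⟨q.den, q.den_nz, (q.num : AddMonoid.End A), ?_⟩
    rw [map_intCast, ← map_nsmul, nsmul_eq_mul, mul_comm, Rat.mul_den_eq_num, map_intCast]

theorem isEngelRing_spanEnd {A V : Type*} [AddCommGroup A] [AddCommGroup V] [Module ℚ V]
    (H : RationalHull A V) (hA : IsEngelRing (AddMonoid.End A)) : IsEngelRing H.spanEnd := by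
  rintro ⟨s, n, hn, f, hf⟩ ⟨t, m, hm, g, hg⟩
  obtain ⟨k, hk⟩ := hA f g
  -- Clearing denominators: each derivation by `s` costs one factor `n`, and `t` costs `m`.
  have hiter : ∀ j : ℕ, (n ^ j * m) • (fun z => s * z - z * s)^[j] t =
      H.extend ((fun z => f * z - z * f)^[j] g) := by
    intro j
    induction j with
    | zero => simpa using hg
    | succ j ih =>
      rw [Function.iterate_succ_apply', Function.iterate_succ_apply', map_sub, map_mul, map_mul,
        ← ih, ← hf, smul_mul_smul_comm, smul_mul_smul_comm, mul_comm _ n, ← mul_assoc,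
        ← pow_succ', smul_sub]
  have hsemi : Function.Semiconj H.spanEnd.val
      (fun z => (⟨s, n, hn, f, hf⟩ : H.spanEnd) * z - z * ⟨s, n, hn, f, hf⟩)
      (fun z => s * z - z * s) := fun z => rfl
  refine ⟨k, Subtype.ext ?_⟩
  have h := hiter k
  rw [hk, map_zero] at h
  refine ((hsemi.iterate_right k).eq _).trans ?_
  have : IsAddTorsionFree (Module.End ℚ V) := IsAddTorsionFree.of_module_rat _
  exact (smul_eq_zero.mp h).resolve_left (mul_ne_zero (pow_ne_zero _ hn) hm)

/-- The rational span of `I` is a right ideal `N` of `H.spanEnd` with `NV = V`, so it contains `1`;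
a denominator of `1` is the required `n`. -/
theorem exists_natCast_mem {A : Type u} {V : Type u} [AddCommGroup A] [AddCommGroup V]
    [Module ℚ V] [FiniteDimensional ℚ V] (H : RationalHull A V)
    (hA : IsEngelRing (AddMonoid.End A)) {I : RightIdeal (AddMonoid.End A)}
    (hI : I.mulGroup = ⊤) : ∃ n : ℕ, n ≠ 0 ∧ (n : AddMonoid.End A) ∈ I := by
  let N : RightIdeal H.spanEnd :=
    { carrier := {t | ∃ n : ℕ, n ≠ 0 ∧ ∃ f ∈ I, n • (t : Module.End ℚ V) = H.extend f}
      zero_mem' := ⟨1, one_ne_zero, 0, I.zero_mem, by simp⟩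
      add_mem' := by
        rintro s t ⟨m, hm, f, hfI, hf⟩ ⟨n, hn, g, hgI, hg⟩
        refine ⟨m * n, mul_ne_zero hm hn, n • f + m • g,
          I.add_mem (I.nsmul_mem hfI n) (I.nsmul_mem hgI m), ?_⟩
        rw [map_add, map_nsmul, map_nsmul, ← hf, ← hg, smul_smul, smul_smul, mul_comm n m,
          ← smul_add]
        rfl
      smul_mem' := by
        rintro ⟨t, n, hn, g, hg⟩ s ⟨m, hm, f, hfI, hf⟩
        refine ⟨m * n, mul_ne_zero hm hn, f * g, I.mul_mem hfI g, ?_⟩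
        rw [map_mul, ← hf, ← hg, smul_mul_smul_comm]
        rfl }
  have : Module.Finite H.spanEnd V := Module.Finite.of_restrictScalars_finite ℚ H.spanEnd V
  have hone : (1 : H.spanEnd) ∈ N := by
    refine N.one_mem_of_smul_eq_top ℚ (W := V) ?_
      (fun e he => (H.isEngelRing_spanEnd hA).commute_of_isIdempotentElem he) ?_
    · intro t ht
      exact Subtype.ext (LinearMap.ext ht)
    · rw [eq_top_iff]
      rintro v -
      obtain ⟨n, hn, a, ha⟩ := H.exists_smul_eq v
      have hv : v = (n : ℚ)⁻¹ • H.incl a := by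
        rw [← ha, ← Nat.cast_smul_eq_nsmul ℚ, smul_smul,
          inv_mul_cancel₀ (Nat.cast_ne_zero.mpr hn), one_smul]
      rw [hv]
      clear hv ha
      have ha : a ∈ I.mulGroup := by rw [hI]; trivial
      induction ha using AddSubgroup.closure_induction with
      | mem x hx =>
        obtain ⟨f, hf, b, rfl⟩ := hx
        refine AddSubgroup.subset_closure ⟨⟨H.extend f, 1, one_ne_zero, f, one_smul _ _⟩,
          ⟨1, one_ne_zero, f, hf, one_smul _ _⟩, (n : ℚ)⁻¹ • H.incl b, ?_⟩
        change H.extend f ((n : ℚ)⁻¹ • H.incl b) = _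
        rw [map_smul, H.extend_incl]
      | zero => simp
      | add x y _ _ hx hy => rw [map_add, smul_add]; exact add_mem hx hy
      | neg x _ hx => rw [map_neg, smul_neg]; exact neg_mem hx
  obtain ⟨n, hn, f, hf, hf1⟩ := hone
  refine ⟨n, hn, ?_⟩
  have : (n : AddMonoid.End A) = f := by
    apply H.extend_injective
    rw [← hf1, map_natCast, nsmul_eq_mul]
    exact (mul_one _).symm
  rwa [this]

open scoped TensorProduct in
/-- The rational hull `ℚ ⊗ A` of a torsion-free group. -/
noncomputable def tensor (A : Type u) [AddCommGroup A] [IsAddTorsionFree A] :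
    RationalHull A (ℚ ⊗[ℤ] A) where
  incl := (TensorProduct.mk ℤ ℚ A 1).toAddMonoidHom
  extend := (Module.End.baseChangeHom ℤ ℚ A).toRingHom.comp
    (addMonoidEndRingEquivInt A).toRingHom
  incl_injective := by
    rw [injective_iff_map_eq_zero]
    intro a ha
    have ha' : TensorProduct.mk ℤ ℚ A 1 a = 0 := ha
    rw [IsLocalizedModule.eq_zero_iff (nonZeroDivisors ℤ)] at ha'
    obtain ⟨⟨c, hc⟩, h⟩ := ha'
    exact (smul_eq_zero.mp h).resolve_left (nonZeroDivisors.ne_zero hc)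
  exists_smul_eq v := by
    obtain ⟨⟨a, c, hc⟩, h⟩ :=
      IsLocalizedModule.surj (nonZeroDivisors ℤ) (TensorProduct.mk ℤ ℚ A 1) v
    have hc0 : c ≠ 0 := nonZeroDivisors.ne_zero hc
    have h' : c • v = TensorProduct.mk ℤ ℚ A 1 a := h
    refine ⟨c.natAbs, Int.natAbs_ne_zero.mpr hc0, c.sign • a, ?_⟩
    change _ = TensorProduct.mk ℤ ℚ A 1 (c.sign • a)
    rw [map_smul, ← h', smul_smul, Int.sign_mul_self_eq_natAbs, natCast_zsmul]
  extend_incl f a := LinearMap.baseChange_tmul _ (1 : ℚ) a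

end RationalHull

/-! ### Conclusion -/

theorem theorem1p4 {A : Type u} [AddCommGroup A] [IsAddTorsionFree A] (hrank : HasFiniteRank A)
    (hA : IsCentrallyEssential (AddMonoid.End A)) : IsFaithfulGroup A := by
  have hfin : FiniteDimensional ℚ (TensorProduct ℤ ℚ A) := by
    rw [FiniteDimensional, ← Module.rank_lt_aleph0_iff]
    have h := IsLocalizedModule.rank_eq (nonZeroDivisors ℤ) le_rfl (TensorProduct.mk ℤ ℚ A 1)
    rw [← IsLocalization.rank_eq ℚ (nonZeroDivisors ℤ) le_rfl] at h
    exact h.trans_lt hrank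
  let H := RationalHull.tensor A
  have hEngel := hA.isEngelRing (k := ℚ) H.extend H.extend_injective
  intro I hproper hI
  obtain ⟨n, hn, hnI⟩ := H.exists_natCast_mem hEngel hI
  refine hproper (eq_top_iff.mpr fun f _ => ?_)
  simpa using I.mul_mem (I.one_mem_of_natCast_mem hrank hEngel hI hn hnI) f
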